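/- Let $\alpha\in\mathbb R$, $\alpha\neq-1$. For an open interval $I\subset\mathbb R$, write $C^1_sC^2_y(\mathbb R^3\times I)$ for the class of vector fields $V(y,s)\in\mathbb R^3$ such that $V$, $\partial_sV$, $D_yV$, $D_y^2V$ exist and are continuous on $\mathbb R^3\times I$; write $\mathbb R^{3+1}=\mathbb R^3\times\mathbb R$. (i) Let $V\in C^1_sC^2_y(\mathbb R^{3+1})$ be a time-periodic solution, with period $S_0>0$, of the self-similar Euler system: $V(y,s+S_0)=V(y,s)$ for all $(y,s)\in\mathbb R^{3+1}$, and for some scalar pressure $P(y,s)$, differentiable in $y$, $$\frac{\partial V}{\partial s}+\frac{\alpha}{\alpha+1}V+\frac{1}{\alpha+1}(y\cdot\nabla)V+(V\cdot\nabla)V=-\nabla P,\qquad \operatorname{div}V=0\qquad\text{on }\mathbb R^{3+1}.$$ If there is an open set $G\subset\mathbb R^3$ containing the origin such that $V=0$ on $G\times(0,S_0)$, then $V=0$ on $\mathbb R^{3+1}$. (ii) Correspondingly, for the Euler equations: let $T>0$, and let $v\in C^1_tC^2_x(\mathbb R^3\times(-\infty,T))$ and a scalar $p(x,t)$, differentiable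 in $x$, satisfy $\partial_tv+(v\cdot\nabla)v=-\nabla p$, $\operatorname{div}v=0$ on $\mathbb R^3\times(-\infty,T)$. Suppose that $(v,p)$ is discretely self-similar: for some $\lambda>0$, $\lambda\ne1$, $$\lambda^{\alpha}v\big(\lambda x,\,T-\lambda^{\alpha+1}(T-t)\big)=v(x,t),\qquad \lambda^{2\alpha}p\big(\lambda x,\,T-\lambda^{\alpha+1}(T-t)\big)=p(x,t)\qquad(x\in\mathbb R^3,\ t<T).$$ Let $V$ be its profile, $V(y,s)=(T-t)^{\frac{\alpha}{\alpha+1}}v(x,t)$ with $x=(T-t)^{\frac1{\alpha+1}}y$ and $s=\log\frac{T}{T-t}$, and let $S_0=|(\alpha+1)\log\lambda|$. If there is an open set $G\subset\mathbb R^3$ containing the origin such that $V=0$ on $G\times(0,S_0)$, then $v=0$ on $\mathbb R^3\times(-\infty,T)$. -/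

import Mathlib

open Set

/-- Physical space `ℝ³` with its Euclidean norm. -/
abbrev Space3 : Type := EuclideanSpace ℝ (Fin 3)

/-- The class `C¹_s C²_y` on `ℝ³ × I` (`I` an open set of times): `V` is `C²` in space and
differentiable in time, and `V`, `∂_s V`, `D_y V`, `D_y² V` are jointly continuous on `ℝ³ × I`. -/
structure IsC1TimeC2Space (I : Set ℝ) (V : Space3 → ℝ → Space3) : Prop where
  differentiable_time : ∀ y : Space3, ∀ s ∈ I, DifferentiableAt ℝ (fun r : ℝ => V y r) s
  continuous_time_deriv :
    ContinuousOn (fun q : Space3 × ℝ => deriv (fun r : ℝ => V q.1 r) q.2)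
      ((univ : Set Space3) ×ˢ I)
  contDiff_space : ∀ s ∈ I, ContDiff ℝ 2 (fun y : Space3 => V y s)
  continuous_space_deriv : ∀ k : ℕ, k ≤ 2 →
    ContinuousOn (fun q : Space3 × ℝ => iteratedFDeriv ℝ k (fun y : Space3 => V y q.2) q.1)
      ((univ : Set Space3) ×ˢ I)

/-- The divergence `∑ᵢ ∂ᵢ Fᵢ` of a vector field on `ℝ³`. -/
noncomputable def divergence (F : Space3 → Space3) (y : Space3) : ℝ :=
  ∑ i : Fin 3, (fderiv ℝ F y (EuclideanSpace.single i (1 : ℝ))) i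

/-- The convective derivative `(u · ∇) F` at the point `y`. -/
noncomputable def convective (u : Space3) (F : Space3 → Space3) (y : Space3) : Space3 :=
  fderiv ℝ F y u

/-- `(V, P)` solves, on `ℝ³ × ℝ`, the self-similar Euler system
`∂_s V + α/(α+1) V + 1/(α+1) (y · ∇) V + (V · ∇) V = -∇P`, `div V = 0`.
(The initial value is just the name `V₀` for `V(·, 0)` and imposes nothing.) -/
structure IsSelfSimilarEulerSolution (α : ℝ) (V : Space3 → ℝ → Space3)
    (P : Space3 → ℝ → ℝ) : Prop where
  differentiable_pressure : ∀ s : ℝ, Differentiable ℝ (fun y : Space3 => P y s)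
  momentum : ∀ (y : Space3) (s : ℝ),
    deriv (fun r : ℝ => V y r) s + (α / (α + 1)) • V y s
      + (1 / (α + 1)) • convective y (fun z : Space3 => V z s) y
      + convective (V y s) (fun z : Space3 => V z s) y
      = -gradient (fun z : Space3 => P z s) y
  div_free : ∀ (y : Space3) (s : ℝ), divergence (fun z : Space3 => V z s) y = 0

/-- `(v, p)` solves the incompressible Euler equations
`∂_t v + (v · ∇) v = -∇p`, `div v = 0` on `ℝ³ × (-∞, T)`. -/
structure IsEulerSolutionBefore (T : ℝ) (v : Space3 → ℝ → Space3)
    (p : Space3 → ℝ → ℝ) : Prop where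
  differentiable_pressure : ∀ t < T, Differentiable ℝ (fun x : Space3 => p x t)
  momentum : ∀ (x : Space3), ∀ t < T,
    deriv (fun r : ℝ => v x r) t + convective (v x t) (fun z : Space3 => v z t) x
      = -gradient (fun z : Space3 => p z t) x
  div_free : ∀ (x : Space3), ∀ t < T, divergence (fun z : Space3 => v z t) x = 0

/-- Discrete self-similarity of `(v, p)` about time `T`, with exponent `α` and factor `l`:
`l^α v(l x, T - l^(α+1) (T-t)) = v(x, t)` and `l^(2α) p(l x, T - l^(α+1) (T-t)) = p(x, t)`. -/
def IsDiscretelySelfSimilar (α l T : ℝ) (v : Space3 → ℝ → Space3)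
    (p : Space3 → ℝ → ℝ) : Prop :=
  (∀ (x : Space3), ∀ t < T, l ^ α • v (l • x) (T - l ^ (α + 1) * (T - t)) = v x t) ∧
  (∀ (x : Space3), ∀ t < T, l ^ (2 * α) * p (l • x) (T - l ^ (α + 1) * (T - t)) = p x t)

/-- The profile `V(y, s) = (T-t)^(α/(α+1)) v(x, t)`, where `x = (T-t)^(1/(α+1)) y` and
`s = log (T/(T-t))`, that is, `T - t = T e^(-s)`. -/
noncomputable def selfSimilarProfile (α T : ℝ) (v : Space3 → ℝ → Space3) (y : Space3) (s : ℝ) :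
    Space3 :=
  (T * Real.exp (-s)) ^ (α / (α + 1)) •
    v ((T * Real.exp (-s)) ^ (1 / (α + 1)) • y) (T - T * Real.exp (-s))

/-! The set where `V` vanishes at all times is enlarged ball by ball. Suppose `V = 0` on the ball of
radius `R`. The vorticity, read as the skew part of `DV`, is transported along `W = y/(α+1) + V`
with a zeroth-order term bounded by a constant times the vorticity. Just outside radius `R` the
field `V` is small, uniformly in time by periodicity, so `W` is dominated by its radial part
`y/(α+1)` and crosses the spheres in one direction, fixed by the sign of `α+1`.

Maximise `|ω| exp(-N|y|²)` over a slightly larger closed ball of radius `ρ` and one period. At a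
positive maximum the time derivative vanishes, and comparison with points further inside along `W`
contradicts the transport bound once `N` is large. Only inward displacements are used, so a maximum
on the boundary does no harm. Hence `ω = 0` up to radius `ρ` (`eq_zero_of_norm_transport_le`, fed by
`exists_hasDerivAt_vorticity`).

There `V` is curl free and divergence free, so its components are harmonic; since they vanish up to
`R`, they vanish up to `√(Rρ) > R` (`eq_zero_of_harmonic_of_eq_zero_on_ball`). Thus no finite radius
is maximal (`exists_larger_ball`). The Euler statement follows because discrete self-similarity of
`v` is time-periodicity of its profile. -/

open MeasureTheory Metric Filter Topology

/-! ### Differentiation under the integral sign. -/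

/-- Differentiation under the integral sign over a compact set, for jointly continuous data. -/
theorem hasFDerivAt_setIntegral_of_continuous {X H F : Type*} [TopologicalSpace X] [T2Space X]
    [SecondCountableTopology X] [MeasurableSpace X] [BorelSpace X] {μ : Measure X}
    [IsFiniteMeasureOnCompacts μ] [NormedAddCommGroup H] [NormedSpace ℝ H] [ProperSpace H]
    [NormedAddCommGroup F] [NormedSpace ℝ F] {f : H → X → F} {f' : H → X → H →L[ℝ] F}
    (hf : Continuous fun q : H × X => f q.1 q.2) (hf' : Continuous fun q : H × X => f' q.1 q.2)
    (h : ∀ z x, HasFDerivAt (fun z => f z x) (f' z x) z) {K : Set X} (hK : IsCompact K) (z₀ : H) :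
    HasFDerivAt (fun z => ∫ x in K, f z x ∂μ) (∫ x in K, f' z₀ x ∂μ) z₀ := by
  obtain ⟨C, hC⟩ := ((isCompact_closedBall z₀ 1).prod hK).exists_bound_of_continuousOn
    (hf'.continuousOn (s := closedBall z₀ 1 ×ˢ K))
  have : IsFiniteMeasure (μ.restrict K) := ⟨by
    rw [Measure.restrict_apply_univ]; exact hK.measure_lt_top⟩
  have hc : ∀ z, Continuous fun x => f z x := fun z =>
    hf.comp (by fun_prop : Continuous fun x => (z, x))
  have hc' : Continuous fun x => f' z₀ x := hf'.comp (by fun_prop : Continuous fun x => (z₀, x))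
  refine hasFDerivAt_integral_of_dominated_of_fderiv_le (bound := fun _ => C)
    (closedBall_mem_nhds z₀ one_pos) ?_ ?_ ?_ ?_ (integrable_const C) ?_
  · exact Eventually.of_forall fun z =>
      ((hc z).continuousOn.integrableOn_compact hK).aestronglyMeasurable
  · exact (hc z₀).continuousOn.integrableOn_compact hK
  · exact (hc'.continuousOn.integrableOn_compact hK).aestronglyMeasurable
  · filter_upwards [ae_restrict_mem hK.measurableSet] with x hx z hz using hC (z, x) ⟨hz, hx⟩
  · exact Eventually.of_forall fun x z _ => h z x

theorem hasFDerivAt_intervalIntegral_of_continuous {H F : Type*} [NormedAddCommGroup H]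
    [NormedSpace ℝ H] [ProperSpace H]
    [NormedAddCommGroup F] [NormedSpace ℝ F] {f : H → ℝ → F} {f' : H → ℝ → H →L[ℝ] F}
    (hf : Continuous fun q : H × ℝ => f q.1 q.2) (hf' : Continuous fun q : H × ℝ => f' q.1 q.2)
    (h : ∀ z x, HasFDerivAt (fun z => f z x) (f' z x) z) (s t : ℝ) (z₀ : H) :
    HasFDerivAt (fun z => ∫ r in s..t, f z r) (∫ r in s..t, f' z₀ r) z₀ := by
  have key : ∀ s t : ℝ, s ≤ t →
      HasFDerivAt (fun z => ∫ r in s..t, f z r) (∫ r in s..t, f' z₀ r) z₀ := by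
    intro s t hst
    simp only [intervalIntegral.integral_of_le hst, ← integral_Icc_eq_integral_Ioc]
    exact hasFDerivAt_setIntegral_of_continuous hf hf' h isCompact_Icc z₀
  rcases le_total s t with hst | hst
  · exact key s t hst
  · simp only [intervalIntegral.integral_symm t s]
    exact (key t s hst).neg

/-! ### Maximum principle for transport inequalities. -/

/-- A maximum principle for time-periodic solutions of transport inequalities: if the
transporting field `W` is transversal to the spheres about the origin wherever `w ≠ 0`, and
`|∂ₛw + (W·∇)w| ≤ K |w|` on a closed ball, then `w` vanishes on that ball. -/
theorem eq_zero_of_norm_transport_le {E F : Type*} [NormedAddCommGroup E] [InnerProductSpace ℝ E]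
    [ProperSpace E] [NormedAddCommGroup F] [NormedSpace ℝ F]
    {w wt : E → ℝ → F} {wx : E → ℝ → E →L[ℝ] F} {W : E → ℝ → E} {S ρ K c σ : ℝ}
    (hS : 0 < S) (hper : ∀ y s, w y (s + S) = w y s)
    (hcont : Continuous fun q : E × ℝ => w q.1 q.2)
    (ht : ∀ y s, HasDerivAt (w y) (wt y s) s)
    (hx : ∀ y s, HasFDerivAt (fun z => w z s) (wx y s) y)
    (hK : ∀ y ∈ closedBall (0 : E) ρ, ∀ s, ‖wt y s + wx y s (W y s)‖ ≤ K * ‖w y s‖)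
    (hc : 0 < c)
    (hW : ∀ y ∈ closedBall (0 : E) ρ, ∀ s, w y s ≠ 0 → c ≤ σ * inner ℝ y (W y s)) :
    ∀ y ∈ closedBall (0 : E) ρ, ∀ s, w y s = 0 := by
  intro y₁ hy₁ s₁
  by_contra hne
  -- Chosen so that `2 N c = |σ| K + 1`, just above the constant `|σ| K` that the transport
  -- inequality allows.
  set N : ℝ := (|σ| * K + 1) / (2 * c) with hN
  set g : E → ℝ → ℝ := fun y s => ‖w y s‖ * Real.exp (-N * ‖y‖ ^ 2) with hg
  have hgc : Continuous fun q : E × ℝ => g q.1 q.2 := by simp only [hg]; fun_prop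
  obtain ⟨⟨y, s⟩, ⟨hy, -⟩, hmax⟩ := ((isCompact_closedBall (0 : E) ρ).prod
    (isCompact_Icc (a := (0 : ℝ)) (b := S))).exists_isMaxOn ⟨(y₁, 0), hy₁, ⟨le_rfl, hS.le⟩⟩
    hgc.continuousOn
  -- Periodicity makes the maximum global in time, so `s` is a critical time even if it is an
  -- endpoint of `[0, S]`.
  have hmax' : ∀ z ∈ closedBall (0 : E) ρ, ∀ r, g z r ≤ g y s := by
    intro z hz r
    have hp : Function.Periodic (g z) S := fun r => by simp only [hg, hper]
    obtain ⟨r', hr', he⟩ := hp.exists_mem_Ico₀ hS r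
    rw [he]
    exact hmax (a := (z, r')) ⟨hz, hr'.1, hr'.2.le⟩
  simp only at hy
  have hpos : 0 < ‖w y s‖ := by
    have h1 : 0 < g y₁ s₁ := mul_pos (norm_pos_iff.2 hne) (Real.exp_pos _)
    exact pos_of_mul_pos_left (h1.trans_le (hmax' y₁ hy₁ s₁)) (Real.exp_pos _).le
  have hwne : w y s ≠ 0 := norm_pos_iff.1 hpos
  -- A norming functional replaces the norm, which need not be differentiable: `ℓ (w ·)` lies below
  -- `‖w ·‖` and touches it at the maximum point.
  obtain ⟨ℓ, hℓ, hℓw⟩ := exists_dual_vector'' ℝ (w y s)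
  simp only [RCLike.ofReal_real_eq_id, id] at hℓw
  have hℓle : ∀ v, ℓ v ≤ ‖v‖ := fun v => (le_abs_self _).trans <| by
    simpa using ℓ.le_of_opNorm_le hℓ v
  set U : E := σ • W y s with hU
  have hyU : c ≤ inner ℝ y U := by
    rw [hU, real_inner_smul_right]; exact hW y hy s hwne
  have hdt : ℓ (wt y s) = 0 := by
    have hd : HasDerivAt (fun r => ℓ (w y r)) (ℓ (wt y s)) s :=
      ℓ.hasFDerivAt.comp_hasDerivAt s (ht y s)
    refine IsLocalMax.hasDerivAt_eq_zero (Eventually.of_forall fun r => ?_) hd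
    have := hmax' y hy r
    simp only [hg] at this
    have := le_of_mul_le_mul_right this (Real.exp_pos _)
    exact (hℓle _).trans (this.trans_eq hℓw.symm)
  -- The right derivative at `τ = 0` of `ℓ (w) exp(-N|·|²)` along the inward path `y - τ U` cannot
  -- be positive.
  have hdx : 0 ≤ ℓ (wx y s U) - 2 * N * inner ℝ y U * ‖w y s‖ := by
    have hline : HasDerivAt (fun τ : ℝ => y - τ • U) (-U) 0 := by
      simpa using ((hasDerivAt_id (0 : ℝ)).smul_const U).const_sub y
    have h1 : HasDerivAt (fun τ : ℝ => ℓ (w (y - τ • U) s)) (-ℓ (wx y s U)) 0 := by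
      have hx0 : HasFDerivAt (fun z => w z s) (wx y s) (y - (0 : ℝ) • U) := by simpa using hx y s
      have := ℓ.hasFDerivAt.comp_hasDerivAt (0 : ℝ) (hx0.comp_hasDerivAt (0 : ℝ) hline)
      simpa using! this
    have h2 : HasDerivAt (fun τ : ℝ => Real.exp (-N * ‖y - τ • U‖ ^ 2))
        (Real.exp (-N * ‖y‖ ^ 2) * (2 * N * inner ℝ y U)) 0 := by
      have := ((hline.norm_sq).const_mul (-N)).exp
      simp only [zero_smul, sub_zero, inner_neg_right] at this
      convert this using 1
      ring
    have h3 := h1.mul h2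
    simp only [zero_smul, sub_zero, hℓw] at h3
    by_contra! hlt
    have hder : 0 < -ℓ (wx y s U) * Real.exp (-N * ‖y‖ ^ 2) +
        ‖w y s‖ * (Real.exp (-N * ‖y‖ ^ 2) * (2 * N * inner ℝ y U)) := by
      have := mul_pos (Real.exp_pos (-N * ‖y‖ ^ 2)) (neg_pos.2 hlt)
      linarith
    -- `|y - τU|² = |y|² - 2τ⟪y, U⟫ + τ²|U|²` is at most `|y|²` as soon as `τ|U|² < 2c`.
    have hev : ∀ᶠ τ in 𝓝[>] (0 : ℝ), y - τ • U ∈ closedBall (0 : E) ρ := by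
      have h4 : ∀ᶠ τ in 𝓝[>] (0 : ℝ), τ * ‖U‖ ^ 2 < 2 * c := by
        refine nhdsWithin_le_nhds <|
          (Continuous.tendsto (by fun_prop) (0 : ℝ)).eventually_lt_const ?_
        simpa using hc
      filter_upwards [h4, self_mem_nhdsWithin] with τ hτ hτ0
      rw [mem_closedBall_zero_iff] at hy ⊢
      refine le_trans (le_of_sq_le_sq ?_ (norm_nonneg y)) hy
      rw [norm_sub_sq_real, norm_smul, real_inner_smul_right, mul_pow, Real.norm_eq_abs, sq_abs]
      have h5 : (0 : ℝ) < τ := hτ0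
      nlinarith [mul_le_mul_of_nonneg_left hyU h5.le, mul_pos h5 (sub_pos.2 hτ)]
    have hslope := (hasDerivAt_iff_tendsto_slope.1 h3).mono_left
      (nhdsWithin_mono (0 : ℝ) (fun _ (hx : (0 : ℝ) < _) => hx.ne') : 𝓝[>] (0 : ℝ) ≤ 𝓝[≠] 0)
    obtain ⟨τ, ⟨hτ1, hτ2⟩, hτ0⟩ :=
      ((hslope.eventually_const_lt hder).and hev).and self_mem_nhdsWithin |>.exists
    have hτ0 : (0 : ℝ) < τ := hτ0
    have h6 := hmax' _ hτ2 s
    simp only [hg] at h6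
    have h7 := mul_le_mul_of_nonneg_right (hℓle (w (y - τ • U) s))
      (Real.exp_pos (-N * ‖y - τ • U‖ ^ 2)).le
    rw [slope_def_field] at hτ1
    have h8 := (div_pos_iff_of_pos_right (by simpa using hτ0)).1 hτ1
    simp only [Pi.mul_apply, zero_smul, sub_zero, hℓw] at h8
    linarith
  have h9 : ℓ (wx y s U) = σ * ℓ (wt y s + wx y s (W y s)) := by
    rw [map_add, hdt, hU, map_smul, map_smul, zero_add, smul_eq_mul]
  have h10 : σ * ℓ (wt y s + wx y s (W y s)) ≤ |σ| * (K * ‖w y s‖) := by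
    refine (le_abs_self _).trans ?_
    rw [abs_mul]
    refine mul_le_mul_of_nonneg_left (le_trans ?_ (hK y hy s)) (abs_nonneg _)
    simpa only [one_mul, Real.norm_eq_abs] using ℓ.le_of_opNorm_le hℓ (wt y s + wx y s (W y s))
  have hKnn : 0 ≤ K := nonneg_of_mul_nonneg_left ((norm_nonneg _).trans (hK y hy s)) hpos
  have hNpos : 0 ≤ N := by positivity
  have h11 : 2 * N * c = |σ| * K + 1 := by rw [hN]; field_simp
  have h12 : N * c * ‖w y s‖ ≤ N * inner ℝ y U * ‖w y s‖ := by gcongr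
  nlinarith

/-! ### Vorticity as a skew form, and elimination of the pressure. -/

set_option maxSynthPendingDepth 3 in
/-- The skew-symmetric part `(e, f) ↦ ⟪A e, f⟫ - ⟪A f, e⟫` of an operator (without the factor
one half), as a bilinear form depending linearly on `A`. For `A = Dv` this is the vorticity. -/
noncomputable def skewForm (E : Type*) [NormedAddCommGroup E] [InnerProductSpace ℝ E] :
    (E →L[ℝ] E) →L[ℝ] E →L[ℝ] E →L[ℝ] ℝ :=
  let B : (E →L[ℝ] E) →L[ℝ] E →L[ℝ] E →L[ℝ] ℝ :=
    ContinuousLinearMap.compL ℝ E E (E →L[ℝ] ℝ)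
      (isBoundedBilinearMap_inner (𝕜 := ℝ) (E := E)).toContinuousLinearMap
  B - (ContinuousLinearMap.flipₗᵢ ℝ E E ℝ).toContinuousLinearEquiv.toContinuousLinearMap ∘L B

section Skew

variable {E : Type*} [NormedAddCommGroup E] [InnerProductSpace ℝ E]

theorem skewForm_apply (A : E →L[ℝ] E) (e f : E) :
    skewForm E A e f = inner ℝ (A e) f - inner ℝ (A f) e := rfl

/-- The terms `⟪A e, A f⟫` cancel. This makes the quadratic term in the differentiated equation
linear in the vorticity, with coefficient `A`. -/
theorem skewForm_comp_self_apply (A : E →L[ℝ] E) (e f : E) :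
    skewForm E (A ∘L A) e f = skewForm E A (A e) f + skewForm E A e (A f) := by
  simp only [skewForm_apply, ContinuousLinearMap.comp_apply, real_inner_comm (A e) (A f)]
  ring

theorem norm_skewForm_comp_self_le (A : E →L[ℝ] E) :
    ‖skewForm E (A ∘L A)‖ ≤ 2 * ‖A‖ * ‖skewForm E A‖ := by
  refine ContinuousLinearMap.opNorm_le_bound₂ _ (by positivity) fun e f => ?_
  rw [skewForm_comp_self_apply]
  have h1 := (skewForm E A).le_opNorm₂ (A e) f
  have h2 := (skewForm E A).le_opNorm₂ e (A f)
  have h3 : ‖skewForm E A‖ * ‖A e‖ * ‖f‖ ≤ ‖skewForm E A‖ * (‖A‖ * ‖e‖) * ‖f‖ := by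
    gcongr; exact A.le_opNorm e
  have h4 : ‖skewForm E A‖ * ‖e‖ * ‖A f‖ ≤ ‖skewForm E A‖ * ‖e‖ * (‖A‖ * ‖f‖) := by
    gcongr; exact A.le_opNorm f
  refine (norm_add_le _ _).trans ?_
  linarith

theorem hasFDerivAt_skewForm_comp {G : Type*} [NormedAddCommGroup G] [NormedSpace ℝ G]
    {A : G → E →L[ℝ] E} {A' : G →L[ℝ] E →L[ℝ] E} {x : G} (h : HasFDerivAt A A' x) :
    HasFDerivAt (fun z => skewForm E (A z)) (skewForm E ∘L A') x :=
  HasFDerivAt.comp (F := E →L[ℝ] E) (G := E →L[ℝ] E →L[ℝ] ℝ) (g := fun B => skewForm E B) x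
    (ContinuousLinearMap.hasFDerivAt (E := E →L[ℝ] E) (F := E →L[ℝ] E →L[ℝ] ℝ) (skewForm E)) h

variable [CompleteSpace E]

/-- If `∇p(·, r)` is jointly continuous, then its time integrals are again gradients. -/
theorem exists_hasGradientAt_intervalIntegral [ProperSpace E] {p : E → ℝ → ℝ} {Γ : E → ℝ → E}
    (hp : ∀ r y, HasGradientAt (fun z => p z r) (Γ y r) y)
    (hΓ : Continuous fun q : E × ℝ => Γ q.1 q.2) (s t : ℝ) :
    ∃ Q : E → ℝ, ∀ y, HasGradientAt Q (∫ r in s..t, Γ y r) y := by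
  have hline : ∀ y r, p y r - p 0 r = ∫ τ in (0 : ℝ)..1, inner ℝ (Γ (τ • y) r) y := by
    intro y r
    have hd : ∀ τ : ℝ, HasDerivAt (fun τ : ℝ => p (τ • y) r) (inner ℝ (Γ (τ • y) r) y) τ := by
      intro τ
      have h1 : HasDerivAt (fun τ : ℝ => τ • y) y τ := by
        simpa using (hasDerivAt_id τ).smul_const y
      simpa using! (hp r (τ • y)).hasFDerivAt.comp_hasDerivAt τ h1
    rw [intervalIntegral.integral_eq_sub_of_hasDerivAt (fun τ _ => hd τ)]
    · simp
    · refine Continuous.intervalIntegrable ?_ _ _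
      exact (hΓ.comp (by fun_prop : Continuous fun τ : ℝ => (τ • y, r))).inner continuous_const
  -- No continuity of `p` in time is assumed; subtracting `p 0 r` leaves a line integral of `Γ`,
  -- which is jointly continuous.
  refine ⟨fun y => ∫ r in s..t, (p y r - p 0 r), fun y => ?_⟩
  have hcont : Continuous fun q : E × ℝ => p q.1 q.2 - p 0 q.2 := by
    simp only [hline]
    refine intervalIntegral.continuous_parametric_intervalIntegral_of_continuous' ?_ _ _
    exact (hΓ.comp (by fun_prop : Continuous fun x : (E × ℝ) × ℝ => (x.2 • x.1.1, x.1.2))).inner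
      (by fun_prop)
  have hcont' : Continuous fun q : E × ℝ => InnerProductSpace.toDual ℝ E (Γ q.1 q.2) := by fun_prop
  have key := hasFDerivAt_intervalIntegral_of_continuous hcont hcont'
    (fun z r => ((hp r z).hasFDerivAt.sub_const (p 0 r))) s t y
  rw [hasGradientAt_iff_hasFDerivAt]
  have hΓy : Continuous fun r => Γ y r := hΓ.comp (by fun_prop : Continuous fun r : ℝ => (y, r))
  have e : InnerProductSpace.toDual ℝ E (∫ r in s..t, Γ y r) =
      ∫ r in s..t, InnerProductSpace.toDual ℝ E (Γ y r) :=
    (ContinuousLinearMap.intervalIntegral_comp_comm (𝕜 := ℝ)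
    (InnerProductSpace.toDual ℝ E).toContinuousLinearEquiv.toContinuousLinearMap
    (hΓy.intervalIntegrable (μ := volume) s t)).symm
  rw [e]
  exact key

/-- The derivative of a differentiable gradient field is symmetric. -/
theorem skewForm_eq_zero_of_hasGradientAt {Q : E → ℝ} {Γ : E → E} {A : E →L[ℝ] E} {y : E}
    (hQ : ∀ z, HasGradientAt Q (Γ z) z) (hΓ : HasFDerivAt Γ A y) : skewForm E A = 0 := by
  ext e f
  have h1 : HasFDerivAt (fun z => InnerProductSpace.toDual ℝ E (Γ z))
      ((InnerProductSpace.toDual ℝ E).toContinuousLinearEquiv.toContinuousLinearMap ∘L A) y :=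
    (InnerProductSpace.toDual ℝ E).toContinuousLinearEquiv.toContinuousLinearMap.hasFDerivAt.comp
      y hΓ
  have h2 := second_derivative_symmetric (fun z => (hQ z).hasFDerivAt) h1 e f
  simpa [skewForm_apply, sub_eq_zero] using! h2

/-- The vorticity equation: the pressure drops out of the equation for the skew part of `Df`,
although `∂ₛf` is merely continuous. -/
theorem hasDerivAt_skewForm [ProperSpace E] {f k Γ : E → ℝ → E} {p : E → ℝ → ℝ}
    {f' k' : E → ℝ → E →L[ℝ] E}
    (hf : ∀ y s, HasDerivAt (f y) (k y s - Γ y s) s)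
    (hp : ∀ s y, HasGradientAt (fun z => p z s) (Γ y s) y)
    (hf' : ∀ y s, HasFDerivAt (fun z => f z s) (f' y s) y)
    (hk' : ∀ y s, HasFDerivAt (fun z => k z s) (k' y s) y)
    (hΓc : Continuous fun q : E × ℝ => Γ q.1 q.2)
    (hkc : Continuous fun q : E × ℝ => k q.1 q.2)
    (hk'c : Continuous fun q : E × ℝ => k' q.1 q.2) (y : E) (s : ℝ) :
    HasDerivAt (fun r => skewForm E (f' y r)) (skewForm E (k' y s)) s := by
  have slice : ∀ {G : Type _} [NormedAddCommGroup G] {g : E → ℝ → G}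
      (_ : Continuous fun q : E × ℝ => g q.1 q.2) (z : E), Continuous (g z) :=
    fun hg z => hg.comp (by fun_prop : Continuous fun r : ℝ => (z, r))
  -- Integrating in time first avoids any mixed derivative of `f`: the integral of `Γ` is a
  -- gradient, and it is differentiable in space because the equation expresses it through `f` and
  -- `k`.
  have key : ∀ r, skewForm E (f' y r) =
      skewForm E (f' y s) + ∫ τ in s..r, skewForm E (k' y τ) := by
    intro r
    obtain ⟨Q, hQ⟩ := exists_hasGradientAt_intervalIntegral hp hΓc s r
    have h1 : ∀ z, ∫ τ in s..r, Γ z τ = (∫ τ in s..r, k z τ) - (f z r - f z s) := by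
      intro z
      have hci := (slice hkc z).intervalIntegrable (μ := volume) s r
      have hΓi := (slice hΓc z).intervalIntegrable (μ := volume) s r
      have := intervalIntegral.integral_eq_sub_of_hasDerivAt (fun τ _ => hf z τ) (hci.sub hΓi)
      rw [← this, intervalIntegral.integral_sub hci hΓi]
      abel
    have h2 : HasFDerivAt (fun z => ∫ τ in s..r, Γ z τ)
        ((∫ τ in s..r, k' y τ) - (f' y r - f' y s)) y := by
      simp only [h1]
      exact (hasFDerivAt_intervalIntegral_of_continuous hkc hk'c hk' s r y).sub
        ((hf' y r).sub (hf' y s))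
    have h3 := skewForm_eq_zero_of_hasGradientAt hQ h2
    rw [map_sub, map_sub, ← ContinuousLinearMap.intervalIntegral_comp_comm (𝕜 := ℝ)
      (E := E →L[ℝ] E) (F := E →L[ℝ] E →L[ℝ] ℝ) (skewForm E)
      ((slice hk'c y).intervalIntegrable (μ := volume) s r)] at h3
    rw [sub_eq_zero.1 h3]
    abel
  rw [show (fun r => skewForm E (f' y r)) =
    fun r => skewForm E (f' y s) + ∫ τ in s..r, skewForm E (k' y τ) from funext key]
  have hc : Continuous fun τ => skewForm E (k' y τ) := (skewForm E).continuous.comp (slice hk'c y)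
  exact (hc.integral_hasStrictDerivAt s s).hasDerivAt.const_add _

end Skew

/-! ### Unique continuation for harmonic functions on concentric balls. -/

theorem hasDerivAt_max_zero_sq (z : ℝ) :
    HasDerivAt (fun z : ℝ => max z 0 ^ 2) (2 * max z 0) z := by
  rcases lt_trichotomy z 0 with h | rfl | h
  · rw [max_eq_right h.le, mul_zero]
    refine (hasDerivAt_const z (0 : ℝ)).congr_of_eventuallyEq ?_
    filter_upwards [Iio_mem_nhds h] with y hy
    simp [max_eq_right (le_of_lt (mem_Iio.1 hy))]
  · rw [max_self, mul_zero, hasDerivAt_iff_isLittleO]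
    refine Asymptotics.IsBigO.trans_isLittleO (g := fun y : ℝ => (y - 0) ^ 2) ?_ ?_
    · refine Asymptotics.IsBigO.of_norm_le fun y => ?_
      rcases le_total y 0 with hy | hy <;> simp [hy, sq_nonneg]
    · simpa using! Asymptotics.isLittleO_pow_id (𝕜 := ℝ) one_lt_two
  · rw [max_eq_left h.le]
    have h1 : HasDerivAt (fun z : ℝ => z ^ 2) (2 * z) z := by simpa using hasDerivAt_pow 2 z
    refine h1.congr_of_eventuallyEq ?_
    filter_upwards [Ioi_mem_nhds h] with y hy
    simp only [max_eq_left (le_of_lt (mem_Ioi.1 hy))]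

theorem hasDerivAt_setIntegral_of_continuous {X F : Type*} [TopologicalSpace X] [T2Space X]
    [SecondCountableTopology X] [MeasurableSpace X] [BorelSpace X] {μ : Measure X}
    [IsFiniteMeasureOnCompacts μ] [NormedAddCommGroup F] [NormedSpace ℝ F] [CompleteSpace F]
    {f f' : ℝ → X → F}
    (hf : Continuous fun q : ℝ × X => f q.1 q.2) (hf' : Continuous fun q : ℝ × X => f' q.1 q.2)
    (h : ∀ z x, HasDerivAt (fun z => f z x) (f' z x) z) {K : Set X} (hK : IsCompact K) (z₀ : ℝ) :
    HasDerivAt (fun z => ∫ x in K, f z x ∂μ) (∫ x in K, f' z₀ x ∂μ) z₀ := by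
  have hc : Continuous fun q : ℝ × X =>
      ContinuousLinearMap.toSpanSingletonCLE (𝕜 := ℝ) (f' q.1 q.2) := by
    fun_prop
  have h1 := (hasFDerivAt_setIntegral_of_continuous (μ := μ) hf hc
    (fun z x => (h z x).hasFDerivAt) hK z₀).hasDerivAt
  convert h1 using 1
  have hi : Integrable (fun x => ContinuousLinearMap.toSpanSingleton ℝ (f' z₀ x))
      (μ.restrict K) :=
    (hc.comp (by fun_prop : Continuous fun x => (z₀, x))).continuousOn.integrableOn_compact hK
  rw [ContinuousLinearMap.integral_apply hi]
  simp

section Harmonic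

variable {E : Type*} [NormedAddCommGroup E]

/-- The weight `(1 - |x|²)₊`, supported in the closed unit ball. -/
def ballWeight {E : Type*} [NormedAddCommGroup E] (x : E) : ℝ := max (1 - ‖x‖ ^ 2) 0

theorem continuous_ballWeight : Continuous (ballWeight : E → ℝ) := by
  unfold ballWeight; fun_prop

theorem ballWeight_nonneg (x : E) : 0 ≤ ballWeight x := le_max_right _ _

theorem ballWeight_pos {x : E} (hx : x ∈ ball (0 : E) 1) : 0 < ballWeight x := by
  rw [mem_ball_zero_iff] at hx
  refine lt_max_of_lt_left ?_
  nlinarith [norm_nonneg x]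

theorem ballWeight_eq_zero {x : E} (hx : x ∉ ball (0 : E) 1) : ballWeight x = 0 := by
  rw [mem_ball_zero_iff, not_lt] at hx
  refine max_eq_right ?_
  nlinarith

variable [InnerProductSpace ℝ E]

/-- Squaring makes the cutoff differentiable across the unit sphere; its gradient `-4 (1-|x|²)₊ x`
is radial, which is what turns Green's identity into one for radial derivatives. -/
theorem hasFDerivAt_ballWeight_sq (x : E) :
    HasFDerivAt (fun x : E => ballWeight x ^ 2) ((-4 * ballWeight x) • innerSL ℝ x) x := by
  have h1 : HasFDerivAt (fun x : E => 1 - ‖x‖ ^ 2) (-(2 • innerSL ℝ x)) x :=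
    (hasStrictFDerivAt_norm_sq x).hasFDerivAt.const_sub 1
  refine ((hasDerivAt_max_zero_sq (1 - ‖x‖ ^ 2)).comp_hasFDerivAt x h1).congr_fderiv ?_
  ext v
  simp [ballWeight]
  ring

omit [InnerProductSpace ℝ E] in
theorem hasCompactSupport_ballWeight [ProperSpace E] : HasCompactSupport (ballWeight : E → ℝ) :=
  HasCompactSupport.of_support_subset_isCompact (isCompact_closedBall (0 : E) 1) fun x hx => by
    by_contra h
    exact hx (ballWeight_eq_zero fun h' => h (ball_subset_closedBall h'))

theorem fderiv_fderiv_comp_smul {u : E → ℝ} (s : ℝ) (x : E) :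
    fderiv ℝ (fderiv ℝ fun y => u (s • y)) x = s ^ 2 • fderiv ℝ (fderiv ℝ u) (s • x) := by
  have h1 : (fderiv ℝ fun y => u (s • y)) = s • fun y => fderiv ℝ u (s • y) :=
    funext fun y => fderiv_comp_smul (f := u) s
  rw [h1, fderiv_const_smul_field (𝕜 := ℝ) (R := ℝ) (F := E →L[ℝ] ℝ), Pi.smul_apply,
    fderiv_comp_smul (f := fderiv ℝ u) s, smul_smul, pow_two]

variable [FiniteDimensional ℝ E] [MeasurableSpace E] [BorelSpace E] {ι : Type*} [Fintype ι]

/-- Green's identity on the spheres about the origin, averaged with weight `(1 - |x|²)₊`. -/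
theorem integral_ballWeight_mul_green (b : OrthonormalBasis ι ℝ E) {f g : E → ℝ}
    (hf : ContDiff ℝ 2 f) (hg : ContDiff ℝ 2 g)
    (hf0 : ∀ x ∈ ball (0 : E) 1, ∑ i, fderiv ℝ (fderiv ℝ f) x (b i) (b i) = 0)
    (hg0 : ∀ x ∈ ball (0 : E) 1, ∑ i, fderiv ℝ (fderiv ℝ g) x (b i) (b i) = 0) :
    ∫ x, ballWeight x * (fderiv ℝ f x x * g x - f x * fderiv ℝ g x x) = 0 := by
  have hfd := hf.differentiable two_ne_zero
  have hgd := hg.differentiable two_ne_zero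
  have hf1 : ContDiff ℝ 1 (fderiv ℝ f) := hf.fderiv_right (by norm_num)
  have hg1 : ContDiff ℝ 1 (fderiv ℝ g) := hg.fderiv_right (by norm_num)
  have hf1d := hf1.differentiable one_ne_zero
  have hg1d := hg1.differentiable one_ne_zero
  have hf2 : Continuous (fderiv ℝ (fderiv ℝ f)) := hf1.continuous_fderiv one_ne_zero
  have hg2 : Continuous (fderiv ℝ (fderiv ℝ g)) := hg1.continuous_fderiv one_ne_zero
  have hfc := hf.continuous
  have hgc := hg.continuous
  have hf1c := hf1.continuous
  have hg1c := hg1.continuous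
  -- The Green field `g ∇f - f ∇g`, divergence free on the unit ball. Integrating its divergence
  -- against the squared weight by parts gives the claim.
  set X : ι → E → ℝ := fun i x => fderiv ℝ f x (b i) * g x - f x * fderiv ℝ g x (b i) with hX
  have hXd : ∀ i x, HasFDerivAt (X i)
      (fderiv ℝ f x (b i) • fderiv ℝ g x + g x • (fderiv ℝ (fderiv ℝ f) x).flip (b i)
        - (f x • (fderiv ℝ (fderiv ℝ g) x).flip (b i) + fderiv ℝ g x (b i) • fderiv ℝ f x)) x := by
    intro i x
    have h1 := (hf1d x).hasFDerivAt.clm_apply (hasFDerivAt_const (b i) x)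
    have h2 := (hg1d x).hasFDerivAt.clm_apply (hasFDerivAt_const (b i) x)
    simp only [ContinuousLinearMap.comp_zero, zero_add] at h1 h2
    exact (h1.mul (hgd x).hasFDerivAt).sub ((hfd x).hasFDerivAt.mul h2)
  have hXv : ∀ i x, fderiv ℝ (X i) x (b i) = g x * fderiv ℝ (fderiv ℝ f) x (b i) (b i)
      - f x * fderiv ℝ (fderiv ℝ g) x (b i) (b i) := by
    intro i x
    rw [(hXd i x).fderiv]
    simp
    ring
  have hXc : ∀ i, Continuous (X i) := fun i => by simp only [hX]; fun_prop
  have hXvc : ∀ i, Continuous fun x => fderiv ℝ (X i) x (b i) := fun i => by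
    simp only [hXv]; fun_prop
  have hΨ : ∀ i x, fderiv ℝ (fun x : E => ballWeight x ^ 2) x (b i) =
      ballWeight x * (-4 * inner ℝ x (b i)) := fun i x => by
    rw [(hasFDerivAt_ballWeight_sq x).fderiv]
    simp
    ring
  have hwc := continuous_ballWeight (E := E)
  have hint : ∀ h : E → ℝ, Continuous h → Integrable fun x => ballWeight x * h x := fun h hh =>
    (hwc.mul hh).integrable_of_hasCompactSupport hasCompactSupport_ballWeight.mul_right
  have hint₁ : ∀ i, Integrable fun x => fderiv ℝ (X i) x (b i) * ballWeight x ^ 2 := fun i =>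
    (hint (fun x => ballWeight x * fderiv ℝ (X i) x (b i)) (hwc.mul (hXvc i))).congr
      (Eventually.of_forall fun x => by dsimp only; ring)
  have hint₂ : ∀ i, Integrable fun x =>
      X i x * fderiv ℝ (fun x : E => ballWeight x ^ 2) x (b i) := fun i =>
    (hint (fun x => X i x * (-4 * inner ℝ x (b i))) (by have := hXc i; fun_prop)).congr
      (Eventually.of_forall fun x => by dsimp only; rw [hΨ]; ring)
  have hibp : ∀ i, ∫ x, X i x * fderiv ℝ (fun x : E => ballWeight x ^ 2) x (b i) =
      -∫ x, fderiv ℝ (X i) x (b i) * ballWeight x ^ 2 := by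
    intro i
    refine integral_mul_fderiv_eq_neg_fderiv_mul_of_integrable ?_ ?_ ?_
      (fun x _ => (hXd i x).differentiableAt)
      (fun x _ => (hasFDerivAt_ballWeight_sq x).differentiableAt)
    · exact hint₁ i
    · exact hint₂ i
    · exact (hint (fun x => ballWeight x * X i x) (hwc.mul (hXc i))).congr
        (Eventually.of_forall fun x => by dsimp only; ring)
  have hsum : ∑ i, ∫ x, X i x * fderiv ℝ (fun x : E => ballWeight x ^ 2) x (b i) = 0 := by
    simp only [hibp, Finset.sum_neg_distrib, neg_eq_zero]
    rw [← integral_finsetSum]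
    · refine integral_eq_zero_of_ae (Eventually.of_forall fun x => ?_)
      by_cases hx : x ∈ ball (0 : E) 1
      · simp only [hXv, Pi.zero_apply, ← Finset.sum_mul, Finset.sum_sub_distrib, ← Finset.mul_sum,
          hf0 x hx, hg0 x hx]
        ring
      · simp [ballWeight_eq_zero hx]
    · exact fun i _ => hint₁ i
  rw [← integral_finsetSum] at hsum
  · have : ∀ x, ∑ i, X i x * fderiv ℝ (fun x : E => ballWeight x ^ 2) x (b i) =
        -4 * (ballWeight x * (fderiv ℝ f x x * g x - f x * fderiv ℝ g x x)) := by
      intro x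
      have hexp : ∀ L : E →L[ℝ] ℝ, L x = ∑ i, inner ℝ x (b i) * L (b i) := by
        intro L
        conv_lhs => rw [← b.sum_repr' x]
        simp [real_inner_comm]
      rw [hexp (fderiv ℝ f x), hexp (fderiv ℝ g x), Finset.sum_mul, Finset.mul_sum,
        ← Finset.sum_sub_distrib, Finset.mul_sum, Finset.mul_sum]
      refine Finset.sum_congr rfl fun i _ => ?_
      rw [hΨ, hX]; ring
    simp only [this, integral_const_mul] at hsum
    simpa using hsum
  · exact fun i _ => hint₂ i

/-- If `u` is harmonic on the ball of radius `ρ` and vanishes on the ball of radius `R`, then it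
vanishes on the ball of radius `√(R ρ)`: the weighted integral of `u (s x) u (t x)` depends on the
product `s t` only. -/
theorem eq_zero_of_harmonic_of_eq_zero_on_ball (b : OrthonormalBasis ι ℝ E) {u : E → ℝ}
    (hu : ContDiff ℝ 2 u) {R ρ : ℝ} (hR : 0 < R) (hRρ : R ≤ ρ)
    (hharm : ∀ x ∈ ball (0 : E) ρ, ∑ i, fderiv ℝ (fderiv ℝ u) x (b i) (b i) = 0)
    (hzero : ∀ x ∈ ball (0 : E) R, u x = 0) :
    ∀ x ∈ ball (0 : E) √(R * ρ), u x = 0 := by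
  set r : ℝ := √(R * ρ) with hr
  have hρ : 0 < ρ := hR.trans_le hRρ
  have hr0 : 0 < r := Real.sqrt_pos.2 (mul_pos hR hρ)
  have hr2 : r * r = R * ρ := Real.mul_self_sqrt (mul_pos hR hρ).le
  have hrρ : r ≤ ρ := by nlinarith
  -- With `r² = R ρ`, the radii `r e^τ` and `r e^(-τ)` run from `r` at `τ = 0` to `ρ` and `R` at `τ
  -- = T`.
  set T : ℝ := Real.log (ρ / r) with hT
  have hT0 : 0 ≤ T := Real.log_nonneg ((one_le_div hr0).2 hrρ)
  have hTe : Real.exp T = ρ / r := Real.exp_log (by positivity)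
  have hud := hu.differentiable two_ne_zero
  have huc := hu.continuous
  have hu1c : Continuous (fderiv ℝ u) := hu.continuous_fderiv two_ne_zero
  have hwc := continuous_ballWeight (E := E)
  set J : ℝ → E → ℝ := fun τ x =>
    ballWeight x * (u ((r * Real.exp τ) • x) * u ((r * Real.exp (-τ)) • x)) with hJ
  set J' : ℝ → E → ℝ := fun τ x => ballWeight x *
    (fderiv ℝ (fun y => u ((r * Real.exp τ) • y)) x x * u ((r * Real.exp (-τ)) • x)
      - u ((r * Real.exp τ) • x) * fderiv ℝ (fun y => u ((r * Real.exp (-τ)) • y)) x x) with hJ'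
  have hJd : ∀ τ x, HasDerivAt (fun τ => J τ x) (J' τ x) τ := by
    intro τ x
    have h1 : HasDerivAt (fun τ : ℝ => (r * Real.exp τ) • x) ((r * Real.exp τ) • x) τ :=
      ((Real.hasDerivAt_exp τ).const_mul r).smul_const x
    have h2 : HasDerivAt (fun τ : ℝ => (r * Real.exp (-τ)) • x) (-((r * Real.exp (-τ)) • x)) τ := by
      have := (((hasDerivAt_neg τ).exp).const_mul r).smul_const x
      convert this using 1
      simp
    have h3 := (hud ((r * Real.exp τ) • x)).hasFDerivAt.comp_hasDerivAt τ h1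
    have h4 := (hud ((r * Real.exp (-τ)) • x)).hasFDerivAt.comp_hasDerivAt τ h2
    refine ((h3.mul h4).const_mul (ballWeight x)).congr_deriv ?_
    simp only [hJ', fderiv_comp_smul (f := u), Function.comp, map_neg, map_smul,
      FunLike.coe_smul, Pi.smul_apply, smul_eq_mul]
    ring
  have hJc : Continuous fun q : ℝ × E => J q.1 q.2 := by simp only [hJ]; fun_prop
  have hJ'c : Continuous fun q : ℝ × E => J' q.1 q.2 := by
    simp only [hJ', fderiv_comp_smul (f := u)]
    fun_prop
  have houtside : ∀ h : E → ℝ, ∫ x in closedBall (0 : E) 1, ballWeight x * h x =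
      ∫ x, ballWeight x * h x := fun h =>
    setIntegral_eq_integral_of_forall_compl_eq_zero fun x hx => by
      rw [ballWeight_eq_zero fun h' => hx (ball_subset_closedBall h'), zero_mul]
  have hGd : ∀ τ, HasDerivAt (fun τ => ∫ x, J τ x) (∫ x, J' τ x) τ := by
    intro τ
    have := hasDerivAt_setIntegral_of_continuous (μ := (volume : Measure E)) hJc hJ'c hJd
      (isCompact_closedBall (0 : E) 1) τ
    simpa only [hJ, hJ', houtside] using this
  -- The derivative is the weighted Green integral of the two rescaled functions, both harmonic on
  -- the unit ball because neither radius exceeds `ρ`.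
  have hJ'0 : ∀ τ ∈ Icc 0 T, ∫ x, J' τ x = 0 := by
    intro τ hτ
    have hsm : ∀ s : ℝ, ContDiff ℝ 2 fun y : E => u (s • y) := fun s => hu.comp (by fun_prop)
    have hh : ∀ s : ℝ, 0 < s → s ≤ ρ → ∀ x ∈ ball (0 : E) 1,
        ∑ i, fderiv ℝ (fderiv ℝ fun y => u (s • y)) x (b i) (b i) = 0 := by
      intro s hs hsρ x hx
      have hmem : s • x ∈ ball (0 : E) ρ := by
        rw [mem_ball_zero_iff] at hx ⊢
        rw [norm_smul, Real.norm_of_nonneg hs.le]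
        nlinarith [norm_nonneg x]
      simp only [fderiv_fderiv_comp_smul, FunLike.coe_smul, Pi.smul_apply,
        ← Finset.smul_sum, hharm _ hmem, smul_zero]
    refine integral_ballWeight_mul_green b (hsm _) (hsm _) (hh _ (by positivity) ?_)
      (hh _ (by positivity) ?_)
    · calc r * Real.exp τ ≤ r * Real.exp T := by gcongr; exact hτ.2
        _ = ρ := by rw [hTe]; field_simp
    · calc r * Real.exp (-τ) ≤ r * 1 := by
            gcongr; exact Real.exp_le_one_iff.2 (neg_nonpos.2 hτ.1)
        _ ≤ ρ := by rwa [mul_one]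
  have hconst := constant_of_has_deriv_right_zero (f := fun τ => ∫ x, J τ x) (a := 0) (b := T)
    (fun τ _ => (hGd τ).continuousAt.continuousWithinAt)
    (fun τ hτ => by
      have := hGd τ
      rw [hJ'0 τ (Ico_subset_Icc_self hτ)] at this
      exact this.hasDerivWithinAt) T (right_mem_Icc.2 hT0)
  have hend : ∫ x, J T x = 0 := by
    refine integral_eq_zero_of_ae (Eventually.of_forall fun x => ?_)
    by_cases hx : x ∈ ball (0 : E) 1
    · have hs : r * Real.exp (-T) = R := by
        rw [Real.exp_neg, hTe]
        field_simp
        linarith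
      have : R • x ∈ ball (0 : E) R := by
        rw [mem_ball_zero_iff] at hx ⊢
        rw [norm_smul, Real.norm_of_nonneg hR.le]
        nlinarith [norm_nonneg x]
      simp [hJ, hs, hzero _ this]
    · simp [hJ, ballWeight_eq_zero hx]
  simp only [hend] at hconst
  intro x hx
  by_contra hne
  have hx1 : r⁻¹ • x ∈ ball (0 : E) 1 := by
    rw [mem_ball_zero_iff] at hx ⊢
    rw [norm_smul, Real.norm_of_nonneg (by positivity), inv_mul_lt_one₀ hr0]
    exact hx
  -- At `τ = 0` the two factors coincide and the integrand is a weighted square.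
  have hpos : 0 < ∫ x, J 0 x := by
    have hJ0c : Continuous (J 0) := hJc.comp (by fun_prop : Continuous fun x : E => ((0 : ℝ), x))
    refine hJ0c.integral_pos_of_hasCompactSupport_nonneg_nonzero (x := r⁻¹ • x)
      hasCompactSupport_ballWeight.mul_right ?_ ?_
    · intro y
      simp only [hJ, neg_zero]
      exact mul_nonneg (ballWeight_nonneg y) (mul_self_nonneg _)
    · simp only [hJ, neg_zero, Real.exp_zero, mul_one, smul_inv_smul₀ hr0.ne']
      exact mul_ne_zero (ballWeight_pos hx1).ne' (mul_self_ne_zero.2 hne)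
  exact hpos.ne hconst

end Harmonic

/-! ### Joint continuity of the spatial derivatives. -/

section IteratedDeriv

variable {X E F : Type*} [TopologicalSpace X] [NormedAddCommGroup E] [NormedSpace ℝ E]
  [NormedAddCommGroup F] [NormedSpace ℝ F] {f : X → E → F} {x : X → E} {s : Set X}

theorem ContinuousOn.of_iteratedFDeriv_zero
    (h : ContinuousOn (fun q => iteratedFDeriv ℝ 0 (f q) (x q)) s) :
    ContinuousOn (fun q => f q (x q)) s := by
  simp only [iteratedFDeriv_zero_eq_comp, Function.comp] at h
  exact (continuousMultilinearCurryFin0 ℝ E F).symm.comp_continuousOn_iff.1 h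

theorem ContinuousOn.iteratedFDeriv_fderiv {n : ℕ}
    (h : ContinuousOn (fun q => iteratedFDeriv ℝ (n + 1) (f q) (x q)) s) :
    ContinuousOn (fun q => iteratedFDeriv ℝ n (fderiv ℝ (f q)) (x q)) s := by
  simp only [iteratedFDeriv_succ_eq_comp_right, Function.comp] at h
  exact (continuousMultilinearCurryRightEquiv' ℝ n E F).symm.comp_continuousOn_iff.1 h

end IteratedDeriv

namespace IsC1TimeC2Space

variable {I : Set ℝ} {V : Space3 → ℝ → Space3}

theorem continuousOn (h : IsC1TimeC2Space I V) :
    ContinuousOn (fun q : Space3 × ℝ => V q.1 q.2) (univ ×ˢ I) :=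
  (h.continuous_space_deriv 0 zero_le_two).of_iteratedFDeriv_zero

theorem continuousOn_fderiv (h : IsC1TimeC2Space I V) :
    ContinuousOn (fun q : Space3 × ℝ => fderiv ℝ (fun z => V z q.2) q.1) (univ ×ˢ I) :=
  (h.continuous_space_deriv 1 one_le_two).iteratedFDeriv_fderiv.of_iteratedFDeriv_zero

theorem continuousOn_fderiv_fderiv (h : IsC1TimeC2Space I V) :
    ContinuousOn (fun q : Space3 × ℝ => fderiv ℝ (fderiv ℝ fun z => V z q.2) q.1) (univ ×ˢ I) :=
  (h.continuous_space_deriv 2 le_rfl).iteratedFDeriv_fderiv.iteratedFDeriv_fderiv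
    |>.of_iteratedFDeriv_zero

end IsC1TimeC2Space

/-! ### Unique continuation for curl-free, divergence-free fields. -/

/-- A `C²` field which is curl free and divergence free on a ball about the origin and vanishes
on a smaller concentric ball of radius `R` vanishes on a ball of radius larger than `R`. -/
theorem eq_zero_of_curl_free_of_div_free {F : Space3 → Space3} (hF : ContDiff ℝ 2 F) {R ρ : ℝ}
    (hR : 0 < R) (hRρ : R ≤ ρ)
    (hcurl : ∀ y ∈ ball (0 : Space3) ρ, skewForm Space3 (fderiv ℝ F y) = 0)
    (hdiv : ∀ y ∈ ball (0 : Space3) ρ, divergence F y = 0)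
    (hzero : ∀ y ∈ ball (0 : Space3) R, F y = 0) :
    ∀ y ∈ ball (0 : Space3) √(R * ρ), F y = 0 := by
  set b := EuclideanSpace.basisFun (Fin 3) ℝ with hb
  have hFd := hF.differentiable two_ne_zero
  have hF1 : ContDiff ℝ 1 (fderiv ℝ F) := hF.fderiv_right (by norm_num)
  have hF1d := hF1.differentiable one_ne_zero
  have hcoord : ∀ j, ContDiff ℝ 2 fun y => F y j := fun j => by fun_prop
  have hcoord1 : ∀ j, fderiv ℝ (fun y => F y j) =
      fun y => (EuclideanSpace.proj j : Space3 →L[ℝ] ℝ) ∘L fderiv ℝ F y := fun j => funext fun y =>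
    ((EuclideanSpace.proj j : Space3 →L[ℝ] ℝ).hasFDerivAt.comp y (hFd y).hasFDerivAt).fderiv
  have hcoord2 : ∀ j y u v, fderiv ℝ (fderiv ℝ fun y => F y j) y u v =
      (fderiv ℝ (fderiv ℝ F) y u v) j := by
    intro j y u v
    rw [hcoord1 j]
    have := (ContinuousLinearMap.compL ℝ Space3 Space3 ℝ
      (EuclideanSpace.proj j : Space3 →L[ℝ] ℝ)).hasFDerivAt.comp y (hF1d y).hasFDerivAt
    have h2 : fderiv ℝ (fun y => (EuclideanSpace.proj j : Space3 →L[ℝ] ℝ) ∘L fderiv ℝ F y) y = _ :=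
      this.fderiv
    rw [h2]
    rfl
  have hskew : ∀ y ∈ ball (0 : Space3) ρ, ∀ u,
      skewForm Space3 (fderiv ℝ (fderiv ℝ F) y u) = 0 := by
    intro y hy u
    have h1 := hasFDerivAt_skewForm_comp (hF1d y).hasFDerivAt
    have h2 : HasFDerivAt (fun y => skewForm Space3 (fderiv ℝ F y)) (0 : Space3 →L[ℝ] _) y := by
      refine (hasFDerivAt_const (0 : Space3 →L[ℝ] Space3 →L[ℝ] ℝ) y).congr_of_eventuallyEq ?_
      filter_upwards [isOpen_ball.mem_nhds hy] with z hz using hcurl z hz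
    exact congrArg (fun L => L u) (h1.unique h2)
  have hdivd : ∀ y ∈ ball (0 : Space3) ρ, ∀ u,
      ∑ i : Fin 3, (fderiv ℝ (fderiv ℝ F) y u (b i)) i = 0 := by
    intro y hy u
    have h1 : HasFDerivAt (divergence F) (∑ i : Fin 3, (EuclideanSpace.proj i : Space3 →L[ℝ] ℝ) ∘L
        (fderiv ℝ (fderiv ℝ F) y).flip (b i)) y := by
      unfold divergence
      refine HasFDerivAt.fun_sum fun i _ => ?_
      have := ((hF1d y).hasFDerivAt.clm_apply (hasFDerivAt_const (b i) y))
      simp only [ContinuousLinearMap.comp_zero, zero_add] at this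
      simpa [hb, Function.comp_def] using!
        (EuclideanSpace.proj i : Space3 →L[ℝ] ℝ).hasFDerivAt.comp y this
    have h2 : HasFDerivAt (divergence F) (0 : Space3 →L[ℝ] ℝ) y := by
      refine (hasFDerivAt_const (0 : ℝ) y).congr_of_eventuallyEq ?_
      filter_upwards [isOpen_ball.mem_nhds hy] with z hz using hdiv z hz
    simpa using congrArg (fun L => L u) (h1.unique h2)
  intro y hy
  ext j
  refine eq_zero_of_harmonic_of_eq_zero_on_ball b (hcoord j) hR hRρ ?_
    (fun z hz => by simp [hzero z hz]) y hy
  -- Here `Δ F_j = ∂_j (div F)`: termwise, symmetry of second derivatives and the differentiated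
  -- curl condition give `∂_i ∂_i F_j = ∂_j ∂_i F_i`.
  intro z hz
  rw [← hdivd z hz (b j)]
  refine Finset.sum_congr rfl fun i _ => ?_
  have hsymm := second_derivative_symmetric (fun y => (hFd y).hasFDerivAt)
    (hF1d z).hasFDerivAt (b j) (b i)
  have hsk := congrArg (fun L => L (b i) (b j)) (hskew z hz (b i))
  simp only [skewForm_apply] at hsk
  have hin : ∀ (v : Space3) k, inner ℝ v (b k) = v k := fun v k => by
    simp [hb, EuclideanSpace.inner_single_right]
  rw [hin, hin] at hsk
  rw [hcoord2, hsymm]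
  exact sub_eq_zero.1 hsk

/-! ### Propagation of the zero set for the self-similar system. -/

/-- Periodicity reduces time to a compact interval, so the tube lemma gives a neighbourhood uniform
in `s`. -/
theorem exists_norm_lt_near_closedBall {E F : Type*} [NormedAddCommGroup E] [NormedSpace ℝ E]
    [ProperSpace E] [NormedAddCommGroup F] {f : E → ℝ → F}
    (hf : Continuous fun q : E × ℝ => f q.1 q.2) {S R ε : ℝ} (hS : 0 < S)
    (hper : ∀ y s, f y (s + S) = f y s) (hR : 0 ≤ R)
    (hzero : ∀ y ∈ closedBall (0 : E) R, ∀ s, f y s = 0) (hε : 0 < ε) :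
    ∃ δ > 0, ∀ y ∈ ball (0 : E) (R + δ), ∀ s, ‖f y s‖ < ε := by
  have hopen : IsOpen {q : E × ℝ | ‖f q.1 q.2‖ < ε} := isOpen_lt hf.norm continuous_const
  have hsub : closedBall (0 : E) R ×ˢ Icc 0 S ⊆ {q : E × ℝ | ‖f q.1 q.2‖ < ε} := by
    rintro ⟨y, s⟩ ⟨hy, -⟩
    simpa only [mem_ofPred_eq, hzero y hy s, norm_zero] using hε
  obtain ⟨u, v, hu, -, hRu, hv, huv⟩ := generalized_tube_lemma (isCompact_closedBall _ _)
    isCompact_Icc hopen hsub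
  obtain ⟨δ, hδ, hth⟩ := (isCompact_closedBall (0 : E) R).exists_thickening_subset_open hu hRu
  rw [thickening_closedBall hδ hR] at hth
  refine ⟨δ, hδ, fun y hy s => ?_⟩
  obtain ⟨s', hs', he⟩ := Function.Periodic.exists_mem_Ico₀ (f := f y) (hper y) hS s
  rw [he]
  have h1 : (y, s') ∈ u ×ˢ v := ⟨hth (by rwa [add_comm]), hv ⟨hs'.1, hs'.2.le⟩⟩
  exact huv h1

namespace IsSelfSimilarEulerSolution

variable {α : ℝ} {V : Space3 → ℝ → Space3} {P : Space3 → ℝ → ℝ}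

set_option maxSynthPendingDepth 3 in
/-- The vorticity of a self-similar Euler solution is differentiable in time, and satisfies a
linear transport inequality along the field `y / (α + 1) + V`. -/
theorem exists_hasDerivAt_vorticity (hsol : IsSelfSimilarEulerSolution α V P)
    (hV : IsC1TimeC2Space univ V) :
    ∃ wt : Space3 → ℝ → Space3 →L[ℝ] Space3 →L[ℝ] ℝ, ∀ y s,
      HasDerivAt (fun r => skewForm Space3 (fderiv ℝ (fun z => V z r) y)) (wt y s) s ∧
      ‖wt y s + skewForm Space3 (fderiv ℝ (fderiv ℝ fun z => V z s) y
          ((1 / (α + 1)) • y + V y s))‖ ≤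
        (|α / (α + 1) + 1 / (α + 1)| + 2 * ‖fderiv ℝ (fun z => V z s) y‖) *
          ‖skewForm Space3 (fderiv ℝ (fun z => V z s) y)‖ := by
  set a := α / (α + 1) with ha
  set b := 1 / (α + 1) with hb
  set A : Space3 → ℝ → Space3 →L[ℝ] Space3 := fun y s => fderiv ℝ (fun z => V z s) y with hA
  set D : Space3 → ℝ → Space3 →L[ℝ] Space3 →L[ℝ] Space3 :=
    fun y s => fderiv ℝ (fderiv ℝ fun z => V z s) y with hD
  have hVc : Continuous fun q : Space3 × ℝ => V q.1 q.2 := by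
    simpa [continuousOn_univ] using hV.continuousOn
  have hAc : Continuous fun q : Space3 × ℝ => A q.1 q.2 := by
    simpa [continuousOn_univ] using hV.continuousOn_fderiv
  have hDc : Continuous fun q : Space3 × ℝ => D q.1 q.2 := by
    simpa [continuousOn_univ] using hV.continuousOn_fderiv_fderiv
  have htc : Continuous fun q : Space3 × ℝ => deriv (V q.1) q.2 := by
    simpa [continuousOn_univ] using hV.continuous_time_deriv
  have hVd : ∀ y s, HasFDerivAt (fun z => V z s) (A y s) y := fun y s =>
    ((hV.contDiff_space s (mem_univ s)).differentiable two_ne_zero y).hasFDerivAt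
  have hAd : ∀ y s, HasFDerivAt (fun z => A z s) (D y s) y := fun y s =>
    ((((hV.contDiff_space s (mem_univ s)).fderiv_right (m := 1) (by norm_num)).differentiable
      one_ne_zero) y).hasFDerivAt
  set W : Space3 → ℝ → Space3 := fun y s => b • y + V y s with hW
  have hWc : Continuous fun q : Space3 × ℝ => W q.1 q.2 := by simp only [hW]; fun_prop
  have hWd : ∀ y s, HasFDerivAt (fun z => W z s) (b • ContinuousLinearMap.id ℝ Space3 + A y s) y :=
    fun y s => ((hasFDerivAt_id y).const_smul b).add (hVd y s)
  set k : Space3 → ℝ → Space3 := fun y s => -(a • V y s + A y s (W y s)) with hk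
  set k' : Space3 → ℝ → Space3 →L[ℝ] Space3 := fun y s =>
    -((a + b) • A y s + A y s ∘L A y s + D y s (W y s)) with hk'
  have hkd : ∀ y s, HasFDerivAt (fun z => k z s) (k' y s) y := by
    intro y s
    have h1 := (((hVd y s).const_smul a).add ((hAd y s).clm_apply (hWd y s))).neg
    refine h1.congr_fderiv ?_
    ext1 e
    -- Symmetry of `D²V` turns the derivative of `A` in direction `e`, applied to `W`, into the
    -- transport term `D W` applied to `e`.
    have hsymm := second_derivative_symmetric (fun z => hVd z s) (hAd y s) e (W y s)
    simp only [hk', neg_apply, add_apply,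
      ContinuousLinearMap.comp_apply, ContinuousLinearMap.flip_apply, hsymm,
      FunLike.coe_smul, Pi.smul_apply, ContinuousLinearMap.id_apply, map_add, map_smul]
    module
  have hmom : ∀ y s, deriv (V y) s = k y s - gradient (fun z => P z s) y := by
    intro y s
    have h1 := hsol.momentum y s
    simp only [convective] at h1
    simp only [hk, hW, map_add, map_smul]
    have h2 : gradient (fun z => P z s) y = -(-gradient (fun z => P z s) y) := (neg_neg _).symm
    rw [h2, ← h1]
    simp only [hA]
    module
  have hkc : Continuous fun q : Space3 × ℝ => k q.1 q.2 := by
    simp only [hk]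
    exact ((hVc.const_smul a).add (hAc.clm_apply hWc)).neg
  have hk'c : Continuous fun q : Space3 × ℝ => k' q.1 q.2 := by
    simp only [hk']
    exact (((hAc.const_smul (a + b)).add (hAc.clm_comp hAc)).add (hDc.clm_apply hWc)).neg
  -- The pressure is only differentiable in space; the joint continuity of its gradient is read off
  -- from the equation.
  have hΓc : Continuous fun q : Space3 × ℝ => gradient (fun z => P z q.2) q.1 := by
    have : (fun q : Space3 × ℝ => gradient (fun z => P z q.2) q.1) =
        fun q => k q.1 q.2 - deriv (V q.1) q.2 := by
      funext q
      rw [hmom]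
      abel
    rw [this]
    exact hkc.sub htc
  refine ⟨fun y s => skewForm Space3 (k' y s), fun y s => ⟨?_, ?_⟩⟩
  · refine hasDerivAt_skewForm (f := V) (k := k) (p := P)
      (Γ := fun y s => gradient (fun z => P z s) y) (fun y s => ?_)
      (fun s y => (hsol.differentiable_pressure s y).hasGradientAt) hVd hkd hΓc hkc hk'c y s
    rw [← hmom]
    exact (hV.differentiable_time y s (mem_univ s)).hasDerivAt
  · have h1 : skewForm Space3 (k' y s) + skewForm Space3 (D y s (W y s)) =
        -((a + b) • skewForm Space3 (A y s) + skewForm Space3 (A y s ∘L A y s)) := by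
      rw [← map_add, ← map_smul, ← map_add, ← map_neg]
      congr 1
      simp only [hk']
      abel
    change ‖skewForm Space3 (k' y s) + skewForm Space3 (D y s (W y s))‖ ≤ _
    rw [h1, norm_neg]
    refine (norm_add_le _ _).trans ?_
    rw [norm_smul, Real.norm_eq_abs, add_mul]
    exact add_le_add le_rfl (norm_skewForm_comp_self_le _)

/-- A time-periodic solution vanishing on a ball about the origin at all times vanishes on a
larger ball. -/
theorem exists_larger_ball (hα : α ≠ -1) (hsol : IsSelfSimilarEulerSolution α V P)
    (hV : IsC1TimeC2Space univ V) {S₀ : ℝ} (hS₀ : 0 < S₀) (hper : ∀ y s, V y (s + S₀) = V y s)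
    {R : ℝ} (hR : 0 < R) (hzero : ∀ y ∈ ball (0 : Space3) R, ∀ s, V y s = 0) :
    ∃ R' > R, ∀ y ∈ ball (0 : Space3) R', ∀ s, V y s = 0 := by
  have hb : 1 / (α + 1) ≠ 0 := one_div_ne_zero fun h => hα (by linarith)
  set b := 1 / (α + 1) with hbdef
  have hVc : Continuous fun q : Space3 × ℝ => V q.1 q.2 := by
    simpa [continuousOn_univ] using hV.continuousOn
  have hAc : Continuous fun q : Space3 × ℝ => fderiv ℝ (fun z => V z q.2) q.1 := by
    simpa [continuousOn_univ] using hV.continuousOn_fderiv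
  have hVs : ∀ s, Continuous fun y => V y s := fun s =>
    hVc.comp (by fun_prop : Continuous fun y : Space3 => (y, s))
  have hperA : ∀ y s, fderiv ℝ (fun z => V z (s + S₀)) y = fderiv ℝ (fun z => V z s) y :=
    fun y s => by simp only [hper]
  have hclosed : ∀ y ∈ closedBall (0 : Space3) R, ∀ s, V y s = 0 := by
    intro y hy s
    rw [← closure_ball (0 : Space3) hR.ne'] at hy
    exact closure_minimal (fun z hz => hzero z hz s)
      (isClosed_eq (hVs s) continuous_const) hy
  -- For `|y| ≥ R` the bound `|V| < |b| R / 2` makes `|⟪y, V⟫|` at most half of `|b| |y|²`, so the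
  -- sign of `b` decides that of `⟪y, W⟫`.
  obtain ⟨δ, hδ, hsmall⟩ := exists_norm_lt_near_closedBall hVc hS₀ hper hR.le hclosed
    (show 0 < |b| * R / 2 by have := abs_pos.2 hb; positivity)
  set ρ := R + δ / 2 with hρ
  have hsubρ : closedBall (0 : Space3) ρ ⊆ ball 0 (R + δ) := closedBall_subset_ball (by linarith)
  obtain ⟨M, hM⟩ := ((isCompact_closedBall (0 : Space3) ρ).prod
    (isCompact_Icc (a := (0 : ℝ)) (b := S₀))).exists_bound_of_continuousOn hAc.continuousOn
  have hM' : ∀ y ∈ closedBall (0 : Space3) ρ, ∀ s, ‖fderiv ℝ (fun z => V z s) y‖ ≤ M := by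
    intro y hy s
    obtain ⟨s', hs', he⟩ := (show Function.Periodic (fun r => fderiv ℝ (fun z => V z r) y) S₀
      from hperA y).exists_mem_Ico₀ hS₀ s
    rw [he]
    exact hM (y, s') ⟨hy, hs'.1, hs'.2.le⟩
  obtain ⟨wt, hwt⟩ := hsol.exists_hasDerivAt_vorticity hV
  have hcurl : ∀ y ∈ closedBall (0 : Space3) ρ, ∀ s,
      skewForm Space3 (fderiv ℝ (fun z => V z s) y) = 0 := by
    refine eq_zero_of_norm_transport_le (wt := wt)
      (wx := fun y s => skewForm Space3 ∘L fderiv ℝ (fderiv ℝ fun z => V z s) y)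
      (W := fun y s => b • y + V y s) (K := |α / (α + 1) + b| + 2 * M) (c := |b| * R ^ 2 / 2)
      (σ := SignType.sign b) hS₀
      (fun y s => by rw [hperA]) ((skewForm Space3).continuous.comp hAc)
      (fun y s => (hwt y s).1) (fun y s => ?_) (fun y hy s => ?_) ?_ ?_
    · exact hasFDerivAt_skewForm_comp
        ((((hV.contDiff_space s (mem_univ s)).fderiv_right (m := 1) (by norm_num)).differentiable
          one_ne_zero) y).hasFDerivAt
    · refine (hwt y s).2.trans ?_
      gcongr
      exact hM' y hy s
    · have : 0 < |b| := abs_pos.2 hb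
      positivity
    · intro y hy s hne
      -- Transversality is needed only where the vorticity is nonzero, which excludes the ball where
      -- `V` already vanishes, the origin included.
      have hRy : R ≤ ‖y‖ := by
        by_contra! hlt
        refine hne ?_
        have : HasFDerivAt (fun z => V z s) (0 : Space3 →L[ℝ] Space3) y := by
          refine (hasFDerivAt_const (0 : Space3) y).congr_of_eventuallyEq ?_
          filter_upwards [isOpen_ball.mem_nhds (mem_ball_zero_iff.2 hlt)] with z hz using
            hzero z hz s
        rw [this.fderiv, map_zero]
      have h1 : |(SignType.sign b : ℝ) * inner ℝ y (V y s)| ≤ ‖y‖ * (|b| * R / 2) := by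
        rw [abs_mul]
        calc |(SignType.sign b : ℝ)| * |inner ℝ y (V y s)| ≤ 1 * (‖y‖ * ‖V y s‖) := by
              gcongr
              · rcases lt_trichotomy b 0 with h | h | h <;> simp [h]
              · exact abs_real_inner_le_norm _ _
          _ ≤ ‖y‖ * (|b| * R / 2) := by
              rw [one_mul]
              gcongr
              exact (hsmall y (hsubρ hy) s).le
      rw [inner_add_right, real_inner_smul_right, real_inner_self_eq_norm_sq, mul_add, ← mul_assoc,
        sign_mul_self]
      have h2 := (abs_le.1 h1).1
      have h3 : |b| * R ^ 2 / 2 ≤ |b| * ‖y‖ ^ 2 / 2 := by gcongr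
      have h4 : ‖y‖ * (|b| * R / 2) ≤ ‖y‖ * (|b| * ‖y‖ / 2) := by gcongr
      linarith
  have hRρ : R < ρ := by linarith
  refine ⟨√(R * ρ), Real.lt_sqrt_of_sq_lt (by nlinarith), fun y hy s => ?_⟩
  exact eq_zero_of_curl_free_of_div_free (hV.contDiff_space s (mem_univ s)) hR hRρ.le
    (fun z hz => hcurl z (ball_subset_closedBall hz) s) (fun z _ => hsol.div_free z s)
    (fun z hz => hzero z hz s) y hy

theorem eq_zero_of_eq_zero_near_origin (hα : α ≠ -1) (hsol : IsSelfSimilarEulerSolution α V P)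
    (hV : IsC1TimeC2Space univ V) {S₀ : ℝ} (hS₀ : 0 < S₀) (hper : ∀ y s, V y (s + S₀) = V y s)
    {G : Set Space3} (hG : IsOpen G) (h0 : (0 : Space3) ∈ G)
    (hzero : ∀ y ∈ G, ∀ s ∈ Ioo 0 S₀, V y s = 0) (y : Space3) (s : ℝ) : V y s = 0 := by
  have hzero' : ∀ y ∈ G, ∀ s, V y s = 0 := by
    intro y hy s
    have hVs : Continuous (V y) := continuous_iff_continuousAt.2 fun s =>
      (hV.differentiable_time y s (mem_univ s)).continuousAt
    obtain ⟨s', hs', he⟩ := (show Function.Periodic (V y) S₀ from hper y).exists_mem_Ico₀ hS₀ s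
    -- Reduction modulo the period may land on `0`, outside the open interval; continuity in time
    -- covers it.
    have hs'' : s' ∈ closure (Ioo 0 S₀) := by
      rw [closure_Ioo hS₀.ne]
      exact ⟨hs'.1, hs'.2.le⟩
    rw [he]
    exact closure_minimal (fun r hr => hzero y hy r hr) (isClosed_eq hVs continuous_const) hs''
  obtain ⟨r₀, hr₀, hball⟩ := Metric.isOpen_iff.1 hG 0 h0
  set Z : Set ℝ := {r | 0 < r ∧ ∀ y ∈ ball (0 : Space3) r, ∀ s, V y s = 0} with hZ
  have hne : Z.Nonempty := ⟨r₀, hr₀, fun y hy s => hzero' y (hball hy) s⟩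
  have hbdd : ¬BddAbove Z := by
    intro hbdd
    have hpos : 0 < sSup Z := hr₀.trans_le (le_csSup hbdd ⟨hr₀, fun y hy s => hzero' y (hball hy) s⟩)
    obtain ⟨R', hR', hz⟩ := hsol.exists_larger_ball hα hV hS₀ hper hpos (fun y hy s => by
      obtain ⟨r, hr, hlt⟩ := exists_lt_of_lt_csSup hne (mem_ball_zero_iff.1 hy)
      exact hr.2 y (mem_ball_zero_iff.2 hlt) s)
    exact hR'.not_ge (le_csSup hbdd ⟨hpos.trans hR', hz⟩)
  obtain ⟨r, hr, hlt⟩ := not_bddAbove_iff.1 hbdd ‖y‖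
  exact hr.2 y (mem_ball_zero_iff.2 hlt) s

end IsSelfSimilarEulerSolution

/-! ### From Euler solutions to their self-similar profiles. -/

/-- Partial regularity in an open set of times implies joint differentiability. -/
theorem IsC1TimeC2Space.hasFDerivAt {I : Set ℝ} (hI : IsOpen I) {v : Space3 → ℝ → Space3}
    (hv : IsC1TimeC2Space I v) (x : Space3) {t : ℝ} (ht : t ∈ I) :
    HasFDerivAt (fun q : Space3 × ℝ => v q.1 q.2) ((fderiv ℝ (fun z => v z t) x).coprod
      (ContinuousLinearMap.toSpanSingleton ℝ (deriv (v x) t))) (x, t) := by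
  have hopen : IsOpen ((univ : Set Space3) ×ˢ I) := isOpen_univ.prod hI
  have hmem : (univ : Set Space3) ×ˢ I ∈ 𝓝 (x, t) := hopen.mem_nhds ⟨mem_univ x, ht⟩
  refine (hasStrictFDerivAt_uncurry_coprod (𝕜 := ℝ) (f := v)
    (f₁ := fun x t => fderiv ℝ (fun z => v z t) x)
    (f₂ := fun x t => ContinuousLinearMap.toSpanSingleton ℝ (deriv (v x) t))
    (u := (x, t)) ?_ ?_ ?_ ?_).hasFDerivAt
  · filter_upwards [hmem] with q hq
    exact ((hv.contDiff_space q.2 hq.2).differentiable two_ne_zero q.1).hasFDerivAt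
  · filter_upwards [hmem] with q hq
    exact (hv.differentiable_time q.1 q.2 hq.2).hasDerivAt.hasFDerivAt
  · exact hv.continuousOn_fderiv.continuousAt hmem
  · exact (ContinuousLinearMap.toSpanSingletonCLE (𝕜 := ℝ) :
      Space3 ≃L[ℝ] (ℝ →L[ℝ] Space3)).continuous.continuousAt.comp
      (hv.continuous_time_deriv.continuousAt hmem)

section Profile

variable {α T : ℝ} {v : Space3 → ℝ → Space3} {p : Space3 → ℝ → ℝ}

theorem hasDerivAt_mul_exp_neg_rpow (hT : 0 < T) (c s : ℝ) :
    HasDerivAt (fun r => (T * Real.exp (-r)) ^ c) (-c * (T * Real.exp (-s)) ^ c) s := by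
  have hpos : 0 < T * Real.exp (-s) := by positivity
  have h1 : HasDerivAt (fun r => T * Real.exp (-r)) (-(T * Real.exp (-s))) s := by
    simpa using ((hasDerivAt_neg s).exp).const_mul T
  refine (h1.rpow_const (p := c) (Or.inl hpos.ne')).congr_deriv ?_
  rw [Real.rpow_sub_one hpos.ne']
  field_simp

theorem continuous_mul_exp_neg_rpow (hT : 0 < T) (c : ℝ) :
    Continuous fun s => (T * Real.exp (-s)) ^ c :=
  continuous_iff_continuousAt.2 fun s => (hasDerivAt_mul_exp_neg_rpow hT c s).continuousAt

theorem sub_mul_exp_neg_lt (hT : 0 < T) (s : ℝ) : T - T * Real.exp (-s) < T := by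
  have : 0 < T * Real.exp (-s) := by positivity
  linarith

theorem rpow_mul_rpow_of_ne_neg_one (hα : α ≠ -1) {θ : ℝ} (hθ : 0 < θ) :
    θ ^ (α / (α + 1)) * θ ^ (1 / (α + 1)) = θ := by
  have h : α + 1 ≠ 0 := fun h => hα (by linarith)
  rw [← Real.rpow_add hθ, ← add_div, div_self h, Real.rpow_one]

/-- Both arguments of `v` move with `s`, so the chain rule rests on joint differentiability; `dt/ds
= T e^(-s) = T - t`. -/
theorem hasDerivAt_selfSimilarProfile (hT : 0 < T) (hv : IsC1TimeC2Space (Iio T) v)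
    (y : Space3) (s : ℝ) :
    HasDerivAt (selfSimilarProfile α T v y)
      ((T * Real.exp (-s)) ^ (α / (α + 1)) •
        (-(α / (α + 1)) • v ((T * Real.exp (-s)) ^ (1 / (α + 1)) • y) (T - T * Real.exp (-s))
          - (1 / (α + 1)) • fderiv ℝ (fun z => v z (T - T * Real.exp (-s)))
              ((T * Real.exp (-s)) ^ (1 / (α + 1)) • y) ((T * Real.exp (-s)) ^ (1 / (α + 1)) • y)
          + (T * Real.exp (-s)) • deriv (v ((T * Real.exp (-s)) ^ (1 / (α + 1)) • y))
              (T - T * Real.exp (-s)))) s := by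
  have h1 : HasDerivAt (fun r => T - T * Real.exp (-r)) (T * Real.exp (-s)) s := by
    simpa using (((hasDerivAt_neg s).exp).const_mul T).const_sub T
  have h2 := (hasDerivAt_mul_exp_neg_rpow hT (1 / (α + 1)) s).smul_const y
  have h3 := (hv.hasFDerivAt isOpen_Iio ((T * Real.exp (-s)) ^ (1 / (α + 1)) • y)
    (mem_Iio.2 (sub_mul_exp_neg_lt hT s))).comp_hasDerivAt s (h2.prodMk h1)
  refine ((hasDerivAt_mul_exp_neg_rpow hT (α / (α + 1)) s).smul h3).congr_deriv ?_
  simp only [ContinuousLinearMap.coprod_apply, ContinuousLinearMap.toSpanSingleton_apply,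
    Function.comp, map_smul, mul_smul, neg_smul, map_neg]
  module

theorem fderiv_selfSimilarProfile (hα : α ≠ -1) (hT : 0 < T) (y : Space3) (s : ℝ) :
    fderiv ℝ (fun z => selfSimilarProfile α T v z s) y =
      (T * Real.exp (-s)) • fderiv ℝ (fun z => v z (T - T * Real.exp (-s)))
        ((T * Real.exp (-s)) ^ (1 / (α + 1)) • y) := by
  have hθ : 0 < T * Real.exp (-s) := by positivity
  have h1 : (fun z => selfSimilarProfile α T v z s) = (T * Real.exp (-s)) ^ (α / (α + 1)) •
      fun z => (fun x => v x (T - T * Real.exp (-s))) ((T * Real.exp (-s)) ^ (1 / (α + 1)) • z) := rfl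
  rw [h1, fderiv_const_smul_field, Pi.smul_apply,
    fderiv_comp_smul (f := fun x => v x (T - T * Real.exp (-s))), smul_smul,
    rpow_mul_rpow_of_ne_neg_one hα hθ]

theorem isC1TimeC2Space_selfSimilarProfile (hT : 0 < T) (hv : IsC1TimeC2Space (Iio T) v) :
    IsC1TimeC2Space univ (selfSimilarProfile α T v) := by
  have hΦ : Continuous fun q : Space3 × ℝ =>
      ((T * Real.exp (-q.2)) ^ (1 / (α + 1)) • q.1, T - T * Real.exp (-q.2)) :=
    (((continuous_mul_exp_neg_rpow hT _).comp continuous_snd).smul continuous_fst).prodMk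
      (by fun_prop)
  have hΦm : ∀ q : Space3 × ℝ, ((T * Real.exp (-q.2)) ^ (1 / (α + 1)) • q.1,
      T - T * Real.exp (-q.2)) ∈ (univ : Set Space3) ×ˢ Iio T := fun q =>
    ⟨mem_univ _, sub_mul_exp_neg_lt hT q.2⟩
  have hpow : ∀ c : ℝ, Continuous fun q : Space3 × ℝ => (T * Real.exp (-q.2)) ^ c := fun c =>
    (continuous_mul_exp_neg_rpow hT c).comp continuous_snd
  have hslice : ∀ s, ContDiff ℝ 2 fun x => v x (T - T * Real.exp (-s)) := fun s =>
    hv.contDiff_space _ (sub_mul_exp_neg_lt hT s)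
  have hscale : ∀ c : ℝ, ContDiff ℝ 2 fun y : Space3 => c • y := fun c => by fun_prop
  refine ⟨fun y s _ => (hasDerivAt_selfSimilarProfile hT hv y s).differentiableAt, ?_, ?_, ?_⟩
  · refine Continuous.continuousOn ?_
    have h0 := hv.continuousOn.comp_continuous hΦ hΦm
    have h1 := (hv.continuousOn_fderiv.comp_continuous hΦ hΦm).clm_apply hΦ.fst
    have h2 := hv.continuous_time_deriv.comp_continuous hΦ hΦm
    have h3 : Continuous fun q : Space3 × ℝ => T * Real.exp (-q.2) := by fun_prop
    have h4 := (hpow (α / (α + 1))).smul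
      (((h0.const_smul (-(α / (α + 1)))).sub (h1.const_smul (1 / (α + 1)))).add (h3.smul h2))
    exact h4.congr fun q => (hasDerivAt_selfSimilarProfile hT hv q.1 q.2).deriv.symm
  · intro s _
    exact ((hslice s).comp (hscale ((T * Real.exp (-s)) ^ (1 / (α + 1))))).const_smul
      ((T * Real.exp (-s)) ^ (α / (α + 1)))
  · intro k hk
    refine Continuous.continuousOn ?_
    have h1 : ∀ q : Space3 × ℝ, iteratedFDeriv ℝ k (fun y => selfSimilarProfile α T v y q.2) q.1 =
        (T * Real.exp (-q.2)) ^ (α / (α + 1)) • ((T * Real.exp (-q.2)) ^ (1 / (α + 1))) ^ k •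
          iteratedFDeriv ℝ k (fun x => v x (T - T * Real.exp (-q.2)))
            ((T * Real.exp (-q.2)) ^ (1 / (α + 1)) • q.1) := by
      intro q
      have hs : ContDiff ℝ k fun x => v x (T - T * Real.exp (-q.2)) :=
        (hslice q.2).of_le (by exact_mod_cast hk)
      have h2 := congrFun (iteratedFDeriv_comp_const_smul ((T * Real.exp (-q.2)) ^ (1 / (α + 1))) hs)
        q.1
      rw [← h2]
      exact iteratedFDeriv_const_smul_apply'
        (hs.comp ((hscale _).of_le (by exact_mod_cast hk))).contDiffAt
    simp only [h1]
    exact (hpow _).smul (((hpow _).pow k).smul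
      ((hv.continuous_space_deriv k hk).comp_continuous hΦ hΦm))

theorem hasGradientAt_mul_comp_smul {f : Space3 → ℝ} (hf : Differentiable ℝ f) (c r : ℝ)
    (y : Space3) :
    HasGradientAt (fun z => c * f (r • z)) ((c * r) • gradient f (r • y)) y := by
  have h1 : HasFDerivAt (fun z : Space3 => r • z) (r • ContinuousLinearMap.id ℝ Space3) y :=
    (hasFDerivAt_id y).const_smul r
  have h2 := (((hf (r • y)).hasGradientAt.hasFDerivAt).comp y h1).const_mul c
  rw [hasGradientAt_iff_hasFDerivAt]
  refine h2.congr_fderiv ?_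
  ext u
  simp [mul_assoc]

theorem isSelfSimilarEulerSolution_selfSimilarProfile (hα : α ≠ -1) (hT : 0 < T)
    (hv : IsC1TimeC2Space (Iio T) v) (hsol : IsEulerSolutionBefore T v p) :
    IsSelfSimilarEulerSolution α (selfSimilarProfile α T v) fun y s =>
      (T * Real.exp (-s)) ^ (α / (α + 1)) * (T * Real.exp (-s)) ^ (α / (α + 1)) *
        p ((T * Real.exp (-s)) ^ (1 / (α + 1)) • y) (T - T * Real.exp (-s)) := by
  have hgrad := fun y s => hasGradientAt_mul_comp_smul
    (hsol.differentiable_pressure _ (sub_mul_exp_neg_lt hT s))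
    ((T * Real.exp (-s)) ^ (α / (α + 1)) * (T * Real.exp (-s)) ^ (α / (α + 1)))
    ((T * Real.exp (-s)) ^ (1 / (α + 1))) y
  refine ⟨fun s y => (hgrad y s).differentiableAt, fun y s => ?_, fun y s => ?_⟩
  · have hθ : 0 < T * Real.exp (-s) := by positivity
    rw [(hgrad y s).gradient, (hasDerivAt_selfSimilarProfile hT hv y s).deriv]
    simp only [convective, fderiv_selfSimilarProfile hα hT]
    simp only [selfSimilarProfile]
    have hmom := hsol.momentum ((T * Real.exp (-s)) ^ (1 / (α + 1)) • y) _ (sub_mul_exp_neg_lt hT s)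
    have hab := rpow_mul_rpow_of_ne_neg_one hα hθ
    simp only [convective] at hmom
    set θ := T * Real.exp (-s)
    set A := θ ^ (α / (α + 1))
    set B := θ ^ (1 / (α + 1))
    rw [mul_assoc A A B, hab, ← smul_neg, ← hmom]
    simp only [FunLike.coe_smul, Pi.smul_apply, map_smul]
    -- Only the `(y · ∇)V` term needs `θ` split as `A B`: its counterpart in `∂_s V` carries `A` and
    -- `B` separately.
    have hθAB : ∀ w : Space3, θ • w = (A * B) • w := fun w => by rw [hab]
    rw [hθAB (fderiv ℝ (fun z => v z (T - θ)) (B • y) y)]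
    module
  · have h1 := hsol.div_free ((T * Real.exp (-s)) ^ (1 / (α + 1)) • y) _ (sub_mul_exp_neg_lt hT s)
    simp only [divergence, fderiv_selfSimilarProfile hα hT, FunLike.coe_smul, Pi.smul_apply,
      PiLp.smul_apply, ← Finset.smul_sum] at h1 ⊢
    rw [h1, smul_zero]

/-- Shifting `s` by `-(α+1) log l` multiplies `T - t` by `l^(α+1)`, hence `x` by `l`, which is the
scaling in the hypothesis. -/
theorem selfSimilarProfile_sub_log (hα : α ≠ -1) (hT : 0 < T) {l : ℝ} (hl : 0 < l)
    (hdss : IsDiscretelySelfSimilar α l T v p) (y : Space3) (s : ℝ) :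
    selfSimilarProfile α T v y (s - (α + 1) * Real.log l) = selfSimilarProfile α T v y s := by
  have hα1 : α + 1 ≠ 0 := fun h => hα (by linarith)
  have hθ : 0 < T * Real.exp (-s) := by positivity
  have hlp : 0 < l ^ (α + 1) := Real.rpow_pos_of_pos hl _
  have h1 : T * Real.exp (-(s - (α + 1) * Real.log l)) = l ^ (α + 1) * (T * Real.exp (-s)) := by
    rw [Real.rpow_def_of_pos hl, neg_sub, sub_eq_add_neg, Real.exp_add, mul_comm (α + 1)]
    ring
  have ha : (l ^ (α + 1) * (T * Real.exp (-s))) ^ (α / (α + 1)) =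
      (T * Real.exp (-s)) ^ (α / (α + 1)) * l ^ α := by
    rw [Real.mul_rpow hlp.le hθ.le, ← Real.rpow_mul hl.le, mul_div_cancel₀ _ hα1, mul_comm]
  have hb : (l ^ (α + 1) * (T * Real.exp (-s))) ^ (1 / (α + 1)) =
      l * (T * Real.exp (-s)) ^ (1 / (α + 1)) := by
    rw [Real.mul_rpow hlp.le hθ.le, ← Real.rpow_mul hl.le, mul_div_cancel₀ _ hα1, Real.rpow_one]
  have h2 := hdss.1 ((T * Real.exp (-s)) ^ (1 / (α + 1)) • y) _ (sub_mul_exp_neg_lt hT s)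
  rw [sub_sub_cancel] at h2
  simp only [selfSimilarProfile, h1, ha, hb]
  rw [mul_smul, mul_smul, h2]

end Profile

/-! ### The main theorem. -/

theorem theorem1p1 (α : ℝ) (hα : α ≠ -1) :
    (∀ (V : Space3 → ℝ → Space3) (S₀ : ℝ), 0 < S₀ →
      IsC1TimeC2Space univ V →
      (∃ P : Space3 → ℝ → ℝ, IsSelfSimilarEulerSolution α V P) →
      (∀ (y : Space3) (s : ℝ), V y (s + S₀) = V y s) →
      ∀ G : Set Space3, IsOpen G → (0 : Space3) ∈ G →
        (∀ y ∈ G, ∀ s ∈ Ioo (0 : ℝ) S₀, V y s = 0) →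
        ∀ (y : Space3) (s : ℝ), V y s = 0) ∧
    (∀ (T l : ℝ) (v : Space3 → ℝ → Space3) (p : Space3 → ℝ → ℝ), 0 < T → 0 < l → l ≠ 1 →
      IsC1TimeC2Space (Iio T) v →
      IsEulerSolutionBefore T v p →
      IsDiscretelySelfSimilar α l T v p →
      ∀ G : Set Space3, IsOpen G → (0 : Space3) ∈ G →
        (∀ y ∈ G, ∀ s ∈ Ioo (0 : ℝ) |(α + 1) * Real.log l|, selfSimilarProfile α T v y s = 0) →
        ∀ (x : Space3), ∀ t < T, v x t = 0) := by
  refine ⟨fun V S₀ hS₀ hV ⟨P, hP⟩ hper G hG h0 hzero y s =>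
    hP.eq_zero_of_eq_zero_near_origin hα hV hS₀ hper hG h0 hzero y s, ?_⟩
  intro T l v p hT hl hl1 hv hsol hdss G hG h0 hzero x t ht
  have hα1 : α + 1 ≠ 0 := fun h => hα (by linarith)
  have hS₀ : 0 < |(α + 1) * Real.log l| :=
    abs_pos.2 (mul_ne_zero hα1 (Real.log_ne_zero_of_pos_of_ne_one hl hl1))
  have hsub := fun y s => selfSimilarProfile_sub_log hα hT hl hdss y s
  have hper : ∀ y s, selfSimilarProfile α T v y (s + |(α + 1) * Real.log l|) =
      selfSimilarProfile α T v y s := by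
    intro y s
    -- The shift may have either sign; a period in one direction is a period in the other.
    rcases abs_choice ((α + 1) * Real.log l) with h | h
    · rw [h, ← hsub y (s + _), add_sub_cancel_right]
    · rw [h, ← sub_eq_add_neg, hsub]
  have hTt : 0 < T - t := sub_pos.2 ht
  have hprofile := isSelfSimilarEulerSolution_selfSimilarProfile hα hT hv hsol
  have hV := hprofile.eq_zero_of_eq_zero_near_origin hα
    (isC1TimeC2Space_selfSimilarProfile hT hv) hS₀ hper hG h0 hzero
    (((T - t) ^ (1 / (α + 1)))⁻¹ • x) (Real.log (T / (T - t)))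
  have hθ : T * Real.exp (-Real.log (T / (T - t))) = T - t := by
    rw [Real.exp_neg, Real.exp_log (div_pos hT hTt)]
    field_simp
  have hb : (T - t) ^ (1 / (α + 1)) ≠ 0 := (Real.rpow_pos_of_pos hTt _).ne'
  rw [selfSimilarProfile, hθ, smul_inv_smul₀ hb, sub_sub_cancel] at hV
  exact (smul_eq_zero.1 hV).resolve_left (Real.rpow_pos_of_pos hTt _).ne'
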